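/- Let $n \ge 1$ and let $M$ be the Chinese monoid of rank $n$, i.e. the monoid with generators $a_1,\dots,a_n$ and defining relations $$a_j a_i a_k = a_j a_k a_i = a_k a_j a_i \qquad \text{for } i \le k \le j .$$ Let $K$ be any field, let $K[M]$ be the monoid algebra, and let $\mathcal{P}$ be the set of minimal prime ideals of $K[M]$. (An ideal is two-sided; a proper ideal $P$ of $K[M]$ is prime if $\alpha K[M] \beta \subseteq P$ implies $\alpha \in P$ or $\beta \in P$; minimal means minimal with respect to inclusion among the prime ideals.) For $P \in \mathcal{P}$ let $\rho_P = \{(s,t) \in M \times M : s - t \in P\}$, a congruence on $M$. Then the natural monoid homomorphism $$M \to \prod_{P \in \mathcal{P}} M/\rho_P, \qquad m \mapsto (m_P)_{P \in \mathcal{P}},$$ where $m_P$ is the class of $m$ in $M/\rho_P$, is injective. Equivalently, $\bigcap_{P \in \mathcal{P}} \rho_P$ is the trivial congruence $\{(m,m) : m \in M\}$. -/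

import Mathlib

/-- The defining relations of the Chinese monoid on generators `a_x`, `x : Fin n`:
`a_j a_i a_k = a_j a_k a_i = a_k a_j a_i` for `i ≤ k ≤ j`. -/
inductive ChineseRel (n : ℕ) : FreeMonoid (Fin n) → FreeMonoid (Fin n) → Prop
  | left (i k j : Fin n) (hik : i ≤ k) (hkj : k ≤ j) :
      ChineseRel n
        (FreeMonoid.of j * FreeMonoid.of i * FreeMonoid.of k)
        (FreeMonoid.of j * FreeMonoid.of k * FreeMonoid.of i)
  | right (i k j : Fin n) (hik : i ≤ k) (hkj : k ≤ j) :
      ChineseRel n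
        (FreeMonoid.of j * FreeMonoid.of k * FreeMonoid.of i)
        (FreeMonoid.of k * FreeMonoid.of j * FreeMonoid.of i)

/-- The Chinese monoid of rank `n`. -/
abbrev ChineseMonoid (n : ℕ) : Type := PresentedMonoid (ChineseRel n)

/-- The Chinese algebra of rank `n` over `K`: the monoid algebra `K[M]` of the Chinese monoid. -/
abbrev ChineseAlgebra (K : Type*) [Field K] (n : ℕ) : Type _ :=
  MonoidAlgebra K (ChineseMonoid n)

/-- Prime ideals of a (not necessarily commutative) ring: a proper two-sided ideal `P` such that
`a R b ⊆ P` implies `a ∈ P` or `b ∈ P`. (Mathlib's `Ideal.IsPrime` is the stronger notion of a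
completely prime ideal.) -/
structure IsPrimeTwoSided {R : Type*} [Ring R] (P : TwoSidedIdeal R) : Prop where
  ne_top : P ≠ ⊤
  mem_or_mem : ∀ a b : R, (∀ r : R, a * r * b ∈ P) → a ∈ P ∨ b ∈ P

/-- The set of minimal prime ideals of a ring: the prime ideals that are minimal, with respect to
inclusion, among all prime ideals. -/
def minimalPrimeIdeals (R : Type*) [Ring R] : Set (TwoSidedIdeal R) :=
  {P | Minimal IsPrimeTwoSided P}

/-- For an ideal `P` of a monoid algebra `K[M]`, the congruence
`ρ_P = {(s, t) ∈ M × M : s - t ∈ P}` on `M`. -/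
def congruenceOfIdeal {K M : Type*} [Field K] [Monoid M]
    (P : TwoSidedIdeal (MonoidAlgebra K M)) : Con M where
  r s t := MonoidAlgebra.of K M s - MonoidAlgebra.of K M t ∈ P
  iseqv :=
    { refl := fun s => by
        rw [sub_self]
        exact P.zero_mem
      symm := fun {s t} h => by
        rw [← neg_sub]
        exact P.neg_mem h
      trans := fun {s t u} h₁ h₂ => by
        rw [← sub_add_sub_cancel _ (MonoidAlgebra.of K M t) _]
        exact P.add_mem h₁ h₂ }
  mul' := fun {s t u v} h₁ h₂ => by
    have h : MonoidAlgebra.of K M (s * u) - MonoidAlgebra.of K M (t * v)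
        = (MonoidAlgebra.of K M s - MonoidAlgebra.of K M t) * MonoidAlgebra.of K M u
          + MonoidAlgebra.of K M t * (MonoidAlgebra.of K M u - MonoidAlgebra.of K M v) := by
      rw [map_mul, map_mul, sub_mul, mul_sub, sub_add_sub_cancel]
    show _ ∈ P
    rw [h]
    exact P.add_mem (P.mul_mem_right _ _ h₁) (P.mul_mem_left _ _ h₂)

/-- The natural homomorphism `M → ∏_P M/ρ_P`, `m ↦ (m_P)_P`, where `P` runs over the minimal prime
ideals of `K[M]` and `m_P` is the class of `m` in `M/ρ_P`. -/
def toProdMinimalPrimes (K M : Type*) [Field K] [Monoid M] :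
    M →* ((P : minimalPrimeIdeals (MonoidAlgebra K M)) → (congruenceOfIdeal P.1).Quotient) :=
  MonoidHom.pi fun P => (congruenceOfIdeal P.1).mk'

/-! By Zorn every prime contains a minimal prime, so it is enough that elements of `M` are separated
by primes of `K[M]`. Each element has a canonical form, a product of rows `(∏_{i<j} (a_j
a_i)^{k_ji}) a_j^{k_jj}`; only existence is proved by rewriting, and the exponents are then read off
from prime quotients.

The primes used are kernels of representations. If `p q = 1`, then sending the generators in order
to `q, …, q, 1, …, 1, p, …, p` respects the relations. With `q`, `p` the shifts on `K[X]` and both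
present, the representation is irreducible, so its kernel is prime; the image of a canonical form is
some `q^a p^b`, which determines `a` and `b`. Varying the two breakpoints gives linear equations on
the exponents (`exponents_eq_of_sums_eq`). The last missing one is the length, seen by the map of
all generators to `X` in the domain `K[X]`. -/

open Polynomial

/-! ### Prime ideals: minimal primes and kernels -/

section PrimeIdeals

variable {R : Type*} [Ring R]

/-- The intersection of a nonempty chain of prime ideals is prime. -/
theorem IsPrimeTwoSided.sInf_of_isChain {c : Set (TwoSidedIdeal R)}
    (hc : ∀ P ∈ c, IsPrimeTwoSided P) (hchain : IsChain (· ≤ ·) c) (hne : c.Nonempty) :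
    IsPrimeTwoSided (sInf c) where
  ne_top h := by
    obtain ⟨P, hP⟩ := hne
    exact (hc P hP).ne_top (top_le_iff.1 (h ▸ sInf_le hP))
  mem_or_mem a b hab := by
    simp only [TwoSidedIdeal.mem_sInf] at hab ⊢
    by_contra! ⟨⟨P, hP, haP⟩, Q, hQ, hbQ⟩
    rcases hchain.total hP hQ with h | h
    · rcases (hc P hP).mem_or_mem a b (fun r => hab r P hP) with h' | h'
      · exact haP h'
      · exact hbQ (h h')
    · rcases (hc Q hQ).mem_or_mem a b (fun r => hab r Q hQ) with h' | h'
      · exact haP (h h')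
      · exact hbQ h'

/-- Every prime ideal contains a minimal prime ideal. -/
theorem IsPrimeTwoSided.exists_minimalPrimeIdeals_le {P : TwoSidedIdeal R}
    (hP : IsPrimeTwoSided P) : ∃ Q ∈ minimalPrimeIdeals R, Q ≤ P := by
  obtain ⟨Q, hQP, hQ⟩ := @zorn_le_nonempty₀ (TwoSidedIdeal R)ᵒᵈ _ {P | IsPrimeTwoSided P}
    (fun c hcS hc y hy => ⟨sInf (α := TwoSidedIdeal R) c,
      IsPrimeTwoSided.sInf_of_isChain (R := R) hcS hc.symm ⟨y, hy⟩,
      fun z hz => sInf_le (α := TwoSidedIdeal R) hz⟩) P hP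
  exact ⟨Q, hQ, hQP⟩

theorem isPrimeTwoSided_ker_of_isDomain {S : Type*} [Ring S] [IsDomain S] (f : R →+* S) :
    IsPrimeTwoSided (TwoSidedIdeal.ker f) where
  ne_top h := by
    have : (1 : R) ∈ TwoSidedIdeal.ker f := h ▸ trivial
    simp [TwoSidedIdeal.mem_ker] at this
  mem_or_mem a b hab := by
    simpa [TwoSidedIdeal.mem_ker] using hab 1

/-- The annihilator of an irreducible representation is prime. -/
theorem isPrimeTwoSided_ker_of_transitive {K V : Type*} [Field K] [AddCommGroup V] [Module K V]
    [Nontrivial V] (f : R →+* Module.End K V) (hf : ∀ v : V, v ≠ 0 → ∀ w, ∃ x, f x v = w) :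
    IsPrimeTwoSided (TwoSidedIdeal.ker f) where
  ne_top h := by
    have : (1 : R) ∈ TwoSidedIdeal.ker f := h ▸ trivial
    simp [TwoSidedIdeal.mem_ker] at this
  mem_or_mem a b hab := by
    simp only [TwoSidedIdeal.mem_ker] at hab ⊢
    by_contra! ⟨ha, hb⟩
    obtain ⟨v, hv⟩ : ∃ v, f b v ≠ 0 := by
      by_contra! h
      exact hb (LinearMap.ext h)
    refine ha (LinearMap.ext fun w => ?_)
    obtain ⟨x, rfl⟩ := hf _ hv w
    simpa using LinearMap.congr_fun (hab x) v

end PrimeIdeals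

/-! ### The bicyclic monoid acting on `K[X]` -/

section Shift

variable (K : Type*) [Field K]

/-- The unilateral shift `X ^ m ↦ X ^ (m + 1)`. -/
noncomputable def shiftUp : Module.End K K[X] := LinearMap.mulLeft K X

/-- The backward shift `X ^ (m + 1) ↦ X ^ m`, `1 ↦ 0`. -/
noncomputable def shiftDown : Module.End K K[X] where
  toFun := divX
  map_add' _ _ := divX_add
  map_smul' a p := by simp [smul_eq_C_mul, divX_C_mul]

theorem shiftDown_mul_shiftUp : shiftDown K * shiftUp K = 1 := by
  refine LinearMap.ext fun p => ?_
  ext m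
  simp [shiftUp, shiftDown, coeff_divX]

theorem shiftUp_pow_apply (a : ℕ) (p : K[X]) : (shiftUp K ^ a) p = X ^ a * p := by
  simp [shiftUp, LinearMap.pow_mulLeft]

theorem shiftDown_pow_apply_X_pow (b m : ℕ) :
    (shiftDown K ^ b) (X ^ m : K[X]) = if b ≤ m then X ^ (m - b) else 0 := by
  induction b with
  | zero => simp
  | succ b ih =>
    rw [pow_succ', Module.End.mul_apply, ih]
    change divX _ = _
    split_ifs with h₁ h₂ h₂
    · rw [divX_X_pow, if_neg (by omega)]
      congr 1
    · rw [divX_X_pow, if_pos (by omega)]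
    · omega
    · exact divX_zero

/-- The operator kills `X ^ m` exactly for `m < b`, which detects `b`; it sends `X ^ b` to `X ^ a`,
which detects `a`. -/
theorem shiftUp_pow_mul_shiftDown_pow_inj {a b a' b' : ℕ}
    (h : shiftUp K ^ a * shiftDown K ^ b = shiftUp K ^ a' * shiftDown K ^ b') :
    a = a' ∧ b = b' := by
  have key (m : ℕ) : X ^ a * (if b ≤ m then X ^ (m - b) else 0) =
      X ^ a' * (if b' ≤ m then X ^ (m - b') else (0 : K[X])) := by
    simpa only [Module.End.mul_apply, shiftDown_pow_apply_X_pow, shiftUp_pow_apply] using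
      LinearMap.congr_fun h (X ^ m)
  have hb : b = b' := by
    rcases lt_trichotomy b b' with hlt | heq | hlt
    · have := key b
      simp [hlt.not_ge] at this
    · exact heq
    · have := (key b').symm
      simp [hlt.not_ge] at this
  subst hb
  refine ⟨?_, rfl⟩
  simpa using congrArg natDegree (key b)

/-- `K[X]` is irreducible under the two shifts. -/
theorem eq_top_of_shift_invariant {N : Submodule K K[X]}
    (hup : ∀ p ∈ N, shiftUp K p ∈ N) (hdown : ∀ p ∈ N, shiftDown K p ∈ N)
    {v : K[X]} (hv : v ≠ 0) (hvN : v ∈ N) : N = ⊤ := by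
  have hone : (1 : K[X]) ∈ N := by
    -- The backward shift lowers the degree by one, until a nonzero constant is left.
    induction hd : v.natDegree generalizing v with
    | zero =>
      rw [eq_C_of_natDegree_eq_zero hd] at hv hvN
      have hc : v.coeff 0 ≠ 0 := fun h => hv (by simp [h])
      have := N.smul_mem (v.coeff 0)⁻¹ hvN
      rwa [smul_C, smul_eq_mul, inv_mul_cancel₀ hc, C_1] at this
    | succ d ih =>
      refine ih (v := divX v) (fun h => ?_) (hdown v hvN) ?_
      · rw [divX_eq_zero_iff] at h
        rw [h] at hd
        simp at hd
      · rw [natDegree_divX_eq_natDegree_tsub_one, hd, Nat.add_sub_cancel]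
  have hpow (m : ℕ) : (X ^ m : K[X]) ∈ N := by
    induction m with
    | zero => simpa using hone
    | succ m ih => simpa [shiftUp, pow_succ'] using hup _ ih
  refine (Submodule.eq_top_iff').2 fun p => ?_
  rw [p.as_sum_range_C_mul_X_pow]
  exact N.sum_mem fun i _ => by simpa [smul_eq_C_mul] using N.smul_mem (p.coeff i) (hpow i)

end Shift

/-! ### Existence of canonical forms -/

section ChineseFamily

variable {M N : Type*} [Monoid M] [Monoid N]

/-- The elements `g 0, …, g (n - 1)` satisfy the Chinese relations. -/
structure IsChineseFamily (n : ℕ) (g : ℕ → M) : Prop where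
  left : ∀ i k j, i ≤ k → k ≤ j → j < n → g j * g i * g k = g j * g k * g i
  right : ∀ i k j, i ≤ k → k ≤ j → j < n → g j * g k * g i = g k * g j * g i

/-- The product of `(g j * g i) ^ e i` over `i < t`. -/
def chinesePairs (g : ℕ → M) (e : ℕ → ℕ) (j : ℕ) : ℕ → M
  | 0 => 1
  | t + 1 => chinesePairs g e j t * (g j * g t) ^ e t

/-- The `j`-th factor of the canonical form. -/
def chineseRow (g : ℕ → M) (e : ℕ → ℕ) (j : ℕ) : M :=
  chinesePairs g e j j * g j ^ e j

/-- The canonical form with exponents `k` in the first `m` generators. -/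
def chineseForm (g : ℕ → M) (k : ℕ → ℕ → ℕ) : ℕ → M
  | 0 => 1
  | m + 1 => chineseForm g k m * chineseRow g (k m) m

theorem chinesePairs_congr {g : ℕ → M} {e e' : ℕ → ℕ} {j t : ℕ} (h : ∀ i < t, e i = e' i) :
    chinesePairs g e j t = chinesePairs g e' j t := by
  induction t with
  | zero => rfl
  | succ t ih =>
    rw [chinesePairs, chinesePairs, ih fun i hi => h i (by omega), h t (by omega)]

theorem chineseRow_congr {g : ℕ → M} {e e' : ℕ → ℕ} {j : ℕ} (h : ∀ i ≤ j, e i = e' i) :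
    chineseRow g e j = chineseRow g e' j := by
  rw [chineseRow, chineseRow, chinesePairs_congr fun i hi => h i hi.le, h j le_rfl]

theorem chineseForm_congr {g : ℕ → M} {k k' : ℕ → ℕ → ℕ} {m : ℕ}
    (h : ∀ j < m, ∀ i ≤ j, k j i = k' j i) : chineseForm g k m = chineseForm g k' m := by
  induction m with
  | zero => rfl
  | succ m ih =>
    rw [chineseForm, chineseForm, ih fun j hj => h j (by omega),
      chineseRow_congr (h m (by omega))]

theorem map_chinesePairs (φ : M →* N) (g : ℕ → M) (e : ℕ → ℕ) (j t : ℕ) :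
    φ (chinesePairs g e j t) = chinesePairs (φ ∘ g) e j t := by
  induction t with
  | zero => simp [chinesePairs]
  | succ t ih => simp [chinesePairs, ih]

theorem map_chineseForm (φ : M →* N) (g : ℕ → M) (k : ℕ → ℕ → ℕ) (m : ℕ) :
    φ (chineseForm g k m) = chineseForm (φ ∘ g) k m := by
  induction m with
  | zero => simp [chineseForm]
  | succ m ih => simp [chineseForm, chineseRow, map_chinesePairs, ih]

theorem chinesePairs_map_congr {g g' : ℕ → M} (e : ℕ → ℕ) {j t : ℕ} (hj : g j = g' j)
    (h : ∀ i < t, g i = g' i) : chinesePairs g e j t = chinesePairs g' e j t := by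
  induction t with
  | zero => rfl
  | succ t ih =>
    rw [chinesePairs, chinesePairs, ih fun i hi => h i (by omega), h t (by omega), hj]

theorem chineseForm_map_congr {g g' : ℕ → M} (k : ℕ → ℕ → ℕ) {m : ℕ}
    (h : ∀ i < m, g i = g' i) : chineseForm g k m = chineseForm g' k m := by
  induction m with
  | zero => rfl
  | succ m ih =>
    rw [chineseForm, chineseForm, chineseRow, chineseRow, ih fun i hi => h i (by omega),
      chinesePairs_map_congr _ (h m (by omega)) fun i hi => h i (by omega), h m (by omega)]

namespace IsChineseFamily

variable {n : ℕ} {g : ℕ → M} (hg : IsChineseFamily n g)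
include hg

theorem commute_pair {i k j : ℕ} (hik : i ≤ k) (hkj : k ≤ j) (hj : j < n) :
    Commute (g j * g i) (g k) := by
  rw [Commute, SemiconjBy, hg.left i k j hik hkj hj, hg.right i k j hik hkj hj, mul_assoc]

theorem commute_pairs {i l j : ℕ} (hi : i ≤ j) (hl : l ≤ j) (hj : j < n) :
    Commute (g j * g i) (g j * g l) := by
  rcases le_total i l with h | h
  · exact (hg.commute_pair hi le_rfl hj).mul_right (hg.commute_pair h hl hj)
  · exact ((hg.commute_pair hl le_rfl hj).mul_right (hg.commute_pair h hi hj)).symm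

theorem pair_mul_chinesePairs {i j t : ℕ} (e : ℕ → ℕ) (hit : i < t) (htj : t ≤ j) (hj : j < n) :
    g j * g i * chinesePairs g e j t = chinesePairs g (e + Pi.single i 1) j t := by
  induction t with
  | zero => omega
  | succ t ih =>
    rw [chinesePairs, chinesePairs]
    rcases Nat.lt_succ_iff_lt_or_eq.1 hit with h | rfl
    · rw [← ih h (by omega), ← mul_assoc]
      simp [h.ne']
    · rw [chinesePairs_congr (e := e + Pi.single i 1) (e' := e) fun l hl => by simp [hl.ne]]
      have hcomm : Commute (g j * g i) (chinesePairs g e j i) := by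
        have (t : ℕ) (ht : t ≤ j) : Commute (g j * g i) (chinesePairs g e j t) := by
          induction t with
          | zero => exact Commute.one_right _
          | succ t ih =>
            exact (ih (by omega)).mul_right
              ((hg.commute_pairs (by omega) (by omega) hj).pow_right _)
        exact this i (by omega)
      rw [← mul_assoc, hcomm.eq, mul_assoc, ← pow_succ']
      simp

theorem commute_chinesePairs {j t : ℕ} (e : ℕ → ℕ) (htj : t ≤ j) (hj : j < n) :
    Commute (g j) (chinesePairs g e j t) := by
  induction t with
  | zero => exact Commute.one_right _
  | succ t ih =>
    exact (ih (by omega)).mul_right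
      ((hg.commute_pair (by omega) le_rfl hj).symm.pow_right _)

theorem exists_pair_mul_chineseRow {i j : ℕ} (e : ℕ → ℕ) (hi : i < j) (hj : j < n) :
    ∃ e', g j * g i * chineseRow g e j = chineseRow g e' j := by
  refine ⟨e + Pi.single i 1, ?_⟩
  rw [chineseRow, chineseRow, ← mul_assoc, hg.pair_mul_chinesePairs e hi le_rfl hj]
  simp [hi.ne']

theorem exists_mul_chineseRow {j : ℕ} (e : ℕ → ℕ) (hj : j < n) :
    ∃ e', g j * chineseRow g e j = chineseRow g e' j := by
  refine ⟨e + Pi.single j 1, ?_⟩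
  rw [chineseRow, chineseRow, ← mul_assoc, (hg.commute_chinesePairs e le_rfl hj).eq, mul_assoc,
    ← pow_succ',
    chinesePairs_congr (e := e + Pi.single j 1) (e' := e) fun l hl => by simp [hl.ne]]
  simp

/-- While `g j` moves right through smaller letters it carries at most one partner, the smallest
letter met so far: a pair commutes with a letter between its two members, and a smaller letter
replaces the partner, which is left behind. -/
theorem exists_mul_eq {j : ℕ} (hj : j < n) {u : M}
    (hu : u ∈ Submonoid.closure (g '' Set.Iio j)) :
    ∃ v ∈ Submonoid.closure (g '' Set.Iio j),
      g j * u = v * g j ∨ ∃ i < j, g j * u = v * (g j * g i) := by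
  induction hu using Submonoid.closure_induction_right with
  | one => exact ⟨1, one_mem _, Or.inl (by simp)⟩
  | mul_right u _ x hx ih =>
    obtain ⟨i, hi, rfl⟩ := hx
    replace hi : i < j := hi
    obtain ⟨v, hv, h | ⟨l, hl, h⟩⟩ := ih
    · exact ⟨v, hv, Or.inr ⟨i, hi, by rw [← mul_assoc, h, mul_assoc]⟩⟩
    · rcases le_total l i with hli | hil
      · refine ⟨v * g i, mul_mem hv (Submonoid.subset_closure ⟨i, hi, rfl⟩),
          Or.inr ⟨l, hl, ?_⟩⟩
        rw [← mul_assoc, h, mul_assoc, (hg.commute_pair hli hi.le hj).eq, mul_assoc]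
      · refine ⟨v * g l, mul_mem hv (Submonoid.subset_closure ⟨l, hl, rfl⟩),
          Or.inr ⟨i, hi, ?_⟩⟩
        rw [← mul_assoc, h, mul_assoc, hg.right i l j hil hl.le hj, mul_assoc, mul_assoc]

omit hg in
theorem _root_.chinesePairs_mem {j t m : ℕ} (e : ℕ → ℕ) (hj : j < m) (ht : t ≤ m) :
    chinesePairs g e j t ∈ Submonoid.closure (g '' Set.Iio m) := by
  induction t with
  | zero => exact one_mem _
  | succ t ih =>
    exact mul_mem (ih (by omega)) (pow_mem (mul_mem
      (Submonoid.subset_closure (Set.mem_image_of_mem g (Set.mem_Iio.2 hj)))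
      (Submonoid.subset_closure (Set.mem_image_of_mem g (Set.mem_Iio.2 (by omega))))) _)

omit hg in
theorem _root_.chineseForm_mem (k : ℕ → ℕ → ℕ) {l m : ℕ} (hl : l ≤ m) :
    chineseForm g k l ∈ Submonoid.closure (g '' Set.Iio m) := by
  induction l with
  | zero => exact one_mem _
  | succ l ih =>
    exact mul_mem (ih (by omega)) (mul_mem (chinesePairs_mem _ (by omega) (by omega))
      (pow_mem (Submonoid.subset_closure (Set.mem_image_of_mem g (Set.mem_Iio.2 (by omega)))) _))

omit hg in
theorem _root_.exists_chineseForm_mul_chineseRow (g : ℕ → M) (k : ℕ → ℕ → ℕ) (e : ℕ → ℕ) (m : ℕ) :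
    ∃ k', chineseForm g k m * chineseRow g e m = chineseForm g k' (m + 1) := by
  refine ⟨Function.update k m e, ?_⟩
  rw [chineseForm, Function.update_self,
    chineseForm_congr (k := Function.update k m e) (k' := k) fun j hj i _ => by
      rw [Function.update_of_ne hj.ne]]

/-- Every element of the submonoid generated by a Chinese family has a canonical form. -/
theorem exists_eq_chineseForm {m : ℕ} (hm : m ≤ n) {x : M}
    (hx : x ∈ Submonoid.closure (g '' Set.Iio m)) : ∃ k, x = chineseForm g k m := by
  induction m generalizing x with
  | zero =>
    refine ⟨0, ?_⟩
    simpa [chineseForm] using hx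
  | succ m ihm =>
    induction hx using Submonoid.closure_induction_left with
    | one =>
      refine ⟨0, ?_⟩
      have hp (j t : ℕ) : chinesePairs g 0 j t = 1 := by
        induction t with
        | zero => rfl
        | succ t ih => simp [chinesePairs, ih]
      have hf (m : ℕ) : chineseForm g 0 m = 1 := by
        induction m with
        | zero => rfl
        | succ m ih => simp [chineseForm, chineseRow, ih, hp]
      rw [hf]
    | mul_left x hx y _ ih =>
      obtain ⟨i, hi, rfl⟩ := hx
      obtain ⟨k, rfl⟩ := ih
      rw [chineseForm, ← mul_assoc]
      -- A smaller letter is absorbed by the first `m` rows; the top letter travels through them,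
      -- alone or paired, and is absorbed by the last row.
      rcases Nat.lt_succ_iff_lt_or_eq.1 (Set.mem_Iio.1 hi) with h | rfl
      · obtain ⟨k', hk'⟩ := ihm (by omega)
          (mul_mem (Submonoid.subset_closure ⟨i, h, rfl⟩) (chineseForm_mem k le_rfl))
        rw [hk']
        exact exists_chineseForm_mul_chineseRow g k' (k m) m
      · obtain ⟨v, hv, h | ⟨l, hl, h⟩⟩ :=
          hg.exists_mul_eq (j := i) (by omega) (chineseForm_mem k le_rfl)
        · obtain ⟨k', rfl⟩ := ihm (by omega) hv
          obtain ⟨e, he⟩ := hg.exists_mul_chineseRow (k i) (j := i) (by omega)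
          rw [h, mul_assoc, he]
          exact exists_chineseForm_mul_chineseRow g k' e i
        · obtain ⟨k', rfl⟩ := ihm (by omega) hv
          obtain ⟨e, he⟩ := hg.exists_pair_mul_chineseRow (k i) hl (by omega)
          rw [h, mul_assoc, he]
          exact exists_chineseForm_mul_chineseRow g k' e i

end IsChineseFamily

end ChineseFamily

/-! ### Canonical forms under the bicyclic families -/

section Bicyclic

variable {B : Type*} [Monoid B]

/-- The family `q, …, q, 1, …, 1, p, …, p` with `q` at the indices below `r` and `p` at the
indices from `s` on. -/
def bicyclicFamily (q p : B) (r s i : ℕ) : B :=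
  if i < r then q else if i < s then 1 else p

/-- Only `q` against `p` fails to commute. By monotonicity the swapped pair then forces the third
factor: `p q p = p p q = p` in the first relation, `p q q = q p q = q` in the second. -/
theorem isChineseFamily_bicyclicFamily {q p : B} (hpq : p * q = 1) (r s n : ℕ) :
    IsChineseFamily n (bicyclicFamily q p r s) where
  left i k j _ _ _ := by
    unfold bicyclicFamily
    split_ifs <;> first | omega | simp [mul_assoc, hpq]
  right i k j hik hkj _ := by
    unfold bicyclicFamily
    split_ifs <;> first | omega | simp [mul_assoc, hpq]

theorem chinesePairs_of_eq {g : ℕ → B} {x : B} {j t : ℕ} (e : ℕ → ℕ) (hj : g j = x)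
    (h : ∀ i < t, g i = x) : chinesePairs g e j t = x ^ (2 * ∑ i ∈ Finset.range t, e i) := by
  induction t with
  | zero => simp [chinesePairs]
  | succ t ih =>
    rw [chinesePairs, ih fun i hi => h i (by omega), hj, h t (by omega), Finset.sum_range_succ,
      ← pow_two, ← pow_mul, ← pow_add, mul_add]

theorem chineseRow_of_eq {g : ℕ → B} {x : B} {j : ℕ} (e : ℕ → ℕ) (h : ∀ i ≤ j, g i = x) :
    chineseRow g e j = x ^ (2 * ∑ i ∈ Finset.range j, e i + e j) := by
  rw [chineseRow, chinesePairs_of_eq e (h j le_rfl) fun i hi => h i hi.le, h j le_rfl, pow_add]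

theorem chineseForm_const (x : B) (k : ℕ → ℕ → ℕ) (m : ℕ) :
    chineseForm (fun _ => x) k m =
      x ^ ∑ j ∈ Finset.range m, (2 * ∑ i ∈ Finset.range j, k j i + k j j) := by
  induction m with
  | zero => simp [chineseForm]
  | succ m ih =>
    rw [chineseForm, ih, chineseRow_of_eq _ fun _ _ => rfl, Finset.sum_range_succ, ← pow_add]

/-- The exponent of `q` in the `j`-th row under `bicyclicFamily q p r s`, for `j < s`. -/
def upExponent (k : ℕ → ℕ → ℕ) (r j : ℕ) : ℕ :=
  if j < r then 2 * ∑ i ∈ Finset.range j, k j i + k j j else ∑ i ∈ Finset.range r, k j i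

theorem chineseRow_bicyclicFamily_of_lt {q p : B} {r s j : ℕ} (k : ℕ → ℕ → ℕ) (hjs : j < s) :
    chineseRow (bicyclicFamily q p r s) (k j) j = q ^ upExponent k r j := by
  unfold upExponent
  split_ifs with hjr
  · exact chineseRow_of_eq _ fun i hi => if_pos (by omega)
  · have hj : bicyclicFamily q p r s j = 1 := by
      rw [bicyclicFamily, if_neg hjr, if_pos hjs]
    have h₁ (t : ℕ) (ht : t ≤ r) : chinesePairs (bicyclicFamily q p r s) (k j) j t =
        q ^ ∑ i ∈ Finset.range t, k j i := by
      induction t with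
      | zero => simp [chinesePairs]
      | succ t ih =>
        rw [chinesePairs, ih (by omega), hj, bicyclicFamily, if_pos (by omega), one_mul,
          Finset.sum_range_succ, pow_add]
    have h₂ (t : ℕ) (hrt : r ≤ t) (htj : t ≤ j) :
        chinesePairs (bicyclicFamily q p r s) (k j) j t = q ^ ∑ i ∈ Finset.range r, k j i := by
      induction t, hrt using Nat.le_induction with
      | base => exact h₁ r le_rfl
      | succ t hrt ih =>
        rw [chinesePairs, ih (by omega), hj, bicyclicFamily, if_neg (by omega),
          if_pos (by omega), one_mul, one_pow, mul_one]
    rw [chineseRow, h₂ j (by omega) le_rfl, hj, one_pow, mul_one]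

theorem chineseForm_bicyclicFamily_of_le {q p : B} {r s m : ℕ} (k : ℕ → ℕ → ℕ) (hms : m ≤ s) :
    chineseForm (bicyclicFamily q p r s) k m =
      q ^ ∑ j ∈ Finset.range m, upExponent k r j := by
  induction m with
  | zero => simp [chineseForm]
  | succ m ih =>
    rw [chineseForm, ih (by omega), chineseRow_bicyclicFamily_of_lt k (by omega),
      Finset.sum_range_succ, pow_add]

/-- From row `s` on, each `q` is preceded by a `p` in its pair and cancels, so these rows contribute
powers of `p` only. -/
theorem exists_chineseForm_bicyclicFamily {q p : B} (hpq : p * q = 1) {r s m : ℕ}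
    (k : ℕ → ℕ → ℕ) (hrs : r ≤ s) (hsm : s ≤ m) :
    ∃ b, chineseForm (bicyclicFamily q p r s) k m =
      q ^ (∑ j ∈ Finset.range s, upExponent k r j) * p ^ b := by
  have hp (e : ℕ → ℕ) {j : ℕ} (hj : s ≤ j) (t : ℕ) :
      ∃ b, chinesePairs (bicyclicFamily q p r s) e j t = p ^ b := by
    induction t with
    | zero => exact ⟨0, by simp [chinesePairs]⟩
    | succ t ih =>
      obtain ⟨b, hb⟩ := ih
      obtain ⟨c, hc⟩ : ∃ c, bicyclicFamily q p r s j * bicyclicFamily q p r s t = p ^ c := by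
        rw [bicyclicFamily, if_neg (by omega), if_neg (by omega), bicyclicFamily]
        split_ifs
        · exact ⟨0, by simp [hpq]⟩
        · exact ⟨1, by simp⟩
        · exact ⟨2, by rw [pow_two]⟩
      exact ⟨b + c * e t, by rw [chinesePairs, hb, hc, pow_add, pow_mul]⟩
  induction m, hsm using Nat.le_induction with
  | base => exact ⟨0, by rw [chineseForm_bicyclicFamily_of_le k le_rfl, pow_zero, mul_one]⟩
  | succ m hsm ih =>
    obtain ⟨b, hb⟩ := ih
    obtain ⟨c, hc⟩ := hp (k m) hsm m
    refine ⟨b + c + k m m, ?_⟩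
    rw [chineseForm, chineseRow, hb, hc, bicyclicFamily, if_neg (by omega), if_neg (by omega),
      pow_add, pow_add, mul_assoc, mul_assoc]

theorem chineseRow_bicyclicFamily_self {q p : B} (hpq : p * q = 1) {r s : ℕ} (e : ℕ → ℕ)
    (hrs : r ≤ s) : chineseRow (bicyclicFamily q p r s) e s =
      p ^ (∑ i ∈ Finset.Ico r s, e i + e s) := by
  have hs : bicyclicFamily q p r s s = p := by
    rw [bicyclicFamily, if_neg (by omega), if_neg (by omega)]
  have h₁ (t : ℕ) (ht : t ≤ r) : chinesePairs (bicyclicFamily q p r s) e s t = 1 := by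
    induction t with
    | zero => rfl
    | succ t ih =>
      rw [chinesePairs, ih (by omega), hs, bicyclicFamily, if_pos (by omega), hpq, one_pow,
        one_mul]
  have h₂ (t : ℕ) (hrt : r ≤ t) (hts : t ≤ s) :
      chinesePairs (bicyclicFamily q p r s) e s t = p ^ ∑ i ∈ Finset.Ico r t, e i := by
    induction t, hrt using Nat.le_induction with
    | base => simp [h₁ r le_rfl]
    | succ t hrt ih =>
      rw [chinesePairs, ih (by omega), hs, bicyclicFamily, if_neg (by omega),
        if_pos (by omega), mul_one, Finset.sum_Ico_succ_top hrt, pow_add]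
  rw [chineseRow, h₂ s hrs le_rfl, hs, pow_add]

end Bicyclic

/-! ### Recovering the exponents -/

/-- The exponents of a canonical form are determined by its images under the bicyclic families
and by its length. -/
theorem exponents_eq_of_sums_eq {n : ℕ} {k k' : ℕ → ℕ → ℕ}
    (hup : ∀ r s, 1 ≤ r → r ≤ s → s ≤ n →
      ∑ j ∈ Finset.range s, upExponent k r j = ∑ j ∈ Finset.range s, upExponent k' r j)
    (hdown : ∀ r, 1 ≤ r → r ≤ n →
      ∑ i ∈ Finset.Ico r n, k n i + k n n = ∑ i ∈ Finset.Ico r n, k' n i + k' n n)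
    (hlen : ∑ j ∈ Finset.range (n + 1), (2 * ∑ i ∈ Finset.range j, k j i + k j j) =
      ∑ j ∈ Finset.range (n + 1), (2 * ∑ i ∈ Finset.range j, k' j i + k' j j)) :
    ∀ j < n + 1, ∀ i ≤ j, k j i = k' j i := by
  -- Raising `s` from `j` to `j + 1` isolates row `j`; raising `r` will then isolate a single entry.
  have hlow (r j : ℕ) (hrj : r ≤ j) (hj : j < n) :
      ∑ i ∈ Finset.range r, k j i = ∑ i ∈ Finset.range r, k' j i := by
    rcases Nat.eq_zero_or_pos r with rfl | hr
    · simp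
    have h₁ := hup r j hr hrj (by omega)
    have h₂ := hup r (j + 1) hr (by omega) (by omega)
    rw [Finset.sum_range_succ, Finset.sum_range_succ, h₁] at h₂
    simpa [upExponent, hrj.not_gt] using h₂
  have hoff (j i : ℕ) (hij : i < j) (hj : j < n) : k j i = k' j i := by
    have h₁ := hlow i j hij.le hj
    have h₂ := hlow (i + 1) j hij hj
    rw [Finset.sum_range_succ, Finset.sum_range_succ] at h₂
    omega
  have hdiagsum (r : ℕ) (hr : r ≤ n) :
      ∑ j ∈ Finset.range r, (2 * ∑ i ∈ Finset.range j, k j i + k j j) =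
        ∑ j ∈ Finset.range r, (2 * ∑ i ∈ Finset.range j, k' j i + k' j j) := by
    rcases Nat.eq_zero_or_pos r with rfl | hr'
    · simp
    -- With `s = r` no generator goes to `1`, so full row lengths, diagonal included, are counted.
    have h := hup r r hr' le_rfl hr
    have hexp (k : ℕ → ℕ → ℕ) : ∑ j ∈ Finset.range r, upExponent k r j =
        ∑ j ∈ Finset.range r, (2 * ∑ i ∈ Finset.range j, k j i + k j j) :=
      Finset.sum_congr rfl fun j hj => if_pos (Finset.mem_range.1 hj)
    rwa [hexp, hexp] at h
  have hdiag (j : ℕ) (hj : j < n) : k j j = k' j j := by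
    have h₁ := hdiagsum j hj.le
    have h₂ := hdiagsum (j + 1) hj
    rw [Finset.sum_range_succ, Finset.sum_range_succ, h₁, hlow j j le_rfl hj] at h₂
    omega
  have hlast : 2 * ∑ i ∈ Finset.range n, k n i + k n n =
      2 * ∑ i ∈ Finset.range n, k' n i + k' n n := by
    rw [Finset.sum_range_succ, Finset.sum_range_succ, hdiagsum n le_rfl] at hlen
    omega
  have hnn : k n n = k' n n := by
    -- In rank one there is no bicyclic family and the length alone decides.
    rcases Nat.eq_zero_or_pos n with rfl | hn
    · simpa using hlast
    · simpa using hdown n hn le_rfl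
  have hn (i : ℕ) (hi : i < n) : k n i = k' n i := by
    have hpos (i : ℕ) (h1 : 1 ≤ i) (hi : i < n) : k n i = k' n i := by
      have h₁ := hdown i h1 hi.le
      have h₂ := hdown (i + 1) (by omega) hi
      rw [Finset.sum_eq_sum_Ico_succ_bot hi, Finset.sum_eq_sum_Ico_succ_bot hi] at h₁
      omega
    rcases Nat.eq_zero_or_pos i with rfl | h1
    -- Since `r ≥ 1`, `hdown` never sees the entry `k n 0`; it comes from the length of the last
    -- row.
    · have h := hdown 1 le_rfl hi
      rw [Finset.range_eq_Ico, Finset.sum_eq_sum_Ico_succ_bot hi,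
        Finset.sum_eq_sum_Ico_succ_bot hi, zero_add] at hlast
      omega
    · exact hpos i h1 hi
  intro j hj i hij
  rcases Nat.lt_succ_iff_lt_or_eq.1 hj with hj' | rfl
  · rcases hij.lt_or_eq with h | rfl
    · exact hoff j i h hj'
    · exact hdiag i hj'
  · rcases hij.lt_or_eq with h | rfl
    · exact hn i h
    · exact hnn

/-! ### Generators and universal property -/

namespace ChineseMonoid

variable {n : ℕ}

/-- The generators of the Chinese monoid, extended by `1`. -/
def gen (n i : ℕ) : ChineseMonoid n :=
  if h : i < n then PresentedMonoid.of (ChineseRel n) ⟨i, h⟩ else 1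

theorem gen_of_lt {i : ℕ} (h : i < n) :
    gen n i = PresentedMonoid.of (ChineseRel n) ⟨i, h⟩ :=
  dif_pos h

theorem isChineseFamily_gen : IsChineseFamily n (gen n) where
  left i k j hik hkj hj := by
    rw [gen_of_lt hj, gen_of_lt (hkj.trans_lt hj), gen_of_lt ((hik.trans hkj).trans_lt hj)]
    exact PresentedMonoid.mk_eq_mk_of_rel (ChineseRel.left _ _ _ hik hkj)
  right i k j hik hkj hj := by
    rw [gen_of_lt hj, gen_of_lt (hkj.trans_lt hj), gen_of_lt ((hik.trans hkj).trans_lt hj)]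
    exact PresentedMonoid.mk_eq_mk_of_rel (ChineseRel.right _ _ _ hik hkj)

theorem exists_eq_chineseForm (x : ChineseMonoid n) : ∃ k, x = chineseForm (gen n) k n := by
  refine isChineseFamily_gen.exists_eq_chineseForm le_rfl ?_
  have h : gen n '' Set.Iio n = Set.range (PresentedMonoid.of (ChineseRel n)) := by
    ext y
    constructor
    · rintro ⟨i, hi, rfl⟩
      exact ⟨⟨i, hi⟩, (gen_of_lt hi).symm⟩
    · rintro ⟨i, rfl⟩
      exact ⟨i, i.2, gen_of_lt i.2⟩
  rw [h, PresentedMonoid.closure_range_of]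
  trivial

/-- The homomorphism from the Chinese monoid defined by a Chinese family. -/
def lift {N : Type*} [Monoid N] {g : ℕ → N} (hg : IsChineseFamily n g) : ChineseMonoid n →* N :=
  PresentedMonoid.lift (fun i : Fin n => g i) fun _ _ h => by
    cases h with
    | left i k j hik hkj => simpa using hg.left i k j hik hkj j.2
    | right i k j hik hkj => simpa using hg.right i k j hik hkj j.2

theorem lift_gen {N : Type*} [Monoid N] {g : ℕ → N} (hg : IsChineseFamily n g) {i : ℕ}
    (hi : i < n) : lift hg (gen n i) = g i := by
  rw [gen_of_lt hi]
  rfl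

theorem lift_chineseForm {N : Type*} [Monoid N] {g : ℕ → N} (hg : IsChineseFamily n g)
    (k : ℕ → ℕ → ℕ) : lift hg (chineseForm (gen n) k n) = chineseForm g k n := by
  rw [map_chineseForm]
  exact chineseForm_map_congr k fun i hi => lift_gen hg hi

end ChineseMonoid

/-! ### Separation by prime ideals -/

section Separation

variable {K M : Type*} [Field K] [Monoid M]

theorem map_eq_of_forall_prime {A : Type*} [Ring A] [Algebra K A] {s t : M}
    (hst : ∀ P : TwoSidedIdeal (MonoidAlgebra K M), IsPrimeTwoSided P →
      MonoidAlgebra.of K M s - MonoidAlgebra.of K M t ∈ P)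
    (φ : M →* A)
    (hφ : IsPrimeTwoSided (TwoSidedIdeal.ker (MonoidAlgebra.lift K A M φ).toRingHom)) :
    φ s = φ t := by
  have h := (TwoSidedIdeal.mem_ker _).1 (hst _ hφ)
  simpa [sub_eq_zero] using h

/-- A representation on `K[X]` whose image contains both shifts is irreducible, so its annihilator
in `K[M]` is prime. -/
theorem isPrimeTwoSided_ker_lift_of_shift (φ : M →* Module.End K K[X]) {x y : M}
    (hx : φ x = shiftUp K) (hy : φ y = shiftDown K) :
    IsPrimeTwoSided
      (TwoSidedIdeal.ker (MonoidAlgebra.lift K (Module.End K K[X]) M φ).toRingHom) := by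
  refine isPrimeTwoSided_ker_of_transitive _ fun v hv w => ?_
  let F := MonoidAlgebra.lift K (Module.End K K[X]) M φ
  -- The cyclic submodule `K[M] v`.
  let N : Submodule K K[X] := LinearMap.range (LinearMap.applyₗ v ∘ₗ F.toLinearMap)
  have hstable (m : M) (p : K[X]) (hp : p ∈ N) : φ m p ∈ N := by
    obtain ⟨a, rfl⟩ := hp
    exact ⟨MonoidAlgebra.of K M m * a, by simp [F]⟩
  have hN : N = ⊤ := eq_top_of_shift_invariant K (fun p hp => hx ▸ hstable x p hp)
    (fun p hp => hy ▸ hstable y p hp) hv ⟨1, by simp [F]⟩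
  have hw : w ∈ N := hN ▸ trivial
  exact hw

end Separation

/-- Elements of the Chinese monoid are separated by the prime ideals of its monoid algebra. -/
theorem ChineseMonoid.eq_of_forall_prime (K : Type*) [Field K] {n : ℕ} (hn : 1 ≤ n)
    {s t : ChineseMonoid n}
    (hst : ∀ P : TwoSidedIdeal (ChineseAlgebra K n), IsPrimeTwoSided P →
      MonoidAlgebra.of K (ChineseMonoid n) s - MonoidAlgebra.of K (ChineseMonoid n) t ∈ P) :
    s = t := by
  -- From here the rank is `n + 1` and `n` is the last index; `1 ≤ r` and `s ≤ n` make generator `0`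
  -- act as `q` and generator `n` as `p`.
  obtain ⟨n, rfl⟩ := Nat.exists_eq_add_of_le' hn
  obtain ⟨k, rfl⟩ := exists_eq_chineseForm s
  obtain ⟨k', rfl⟩ := exists_eq_chineseForm t
  have hpq := shiftDown_mul_shiftUp K
  have hrep (r s : ℕ) (hr : 1 ≤ r) (hrs : r ≤ s) (hs : s ≤ n) :
      chineseForm (bicyclicFamily (shiftUp K) (shiftDown K) r s) k (n + 1) =
        chineseForm (bicyclicFamily (shiftUp K) (shiftDown K) r s) k' (n + 1) := by
    have hB := isChineseFamily_bicyclicFamily hpq r s (n + 1)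
    have h := map_eq_of_forall_prime hst (lift hB)
      (isPrimeTwoSided_ker_lift_of_shift _ (x := gen (n + 1) 0) (y := gen (n + 1) n)
        (by rw [lift_gen hB (by omega), bicyclicFamily, if_pos (by omega)])
        (by rw [lift_gen hB (by omega), bicyclicFamily, if_neg (by omega), if_neg (by omega)]))
    rwa [lift_chineseForm, lift_chineseForm] at h
  refine chineseForm_congr (exponents_eq_of_sums_eq (fun r s hr hrs hs => ?_)
    (fun r hr hrn => ?_) ?_)
  · have h := hrep r s hr hrs hs
    obtain ⟨b, hb⟩ := exists_chineseForm_bicyclicFamily hpq k hrs (m := n + 1) (by omega)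
    obtain ⟨b', hb'⟩ := exists_chineseForm_bicyclicFamily hpq k' hrs (m := n + 1) (by omega)
    rw [hb, hb'] at h
    exact (shiftUp_pow_mul_shiftDown_pow_inj K h).1
  · have h := hrep r n hr hrn le_rfl
    rw [chineseForm, chineseForm, chineseForm_bicyclicFamily_of_le k le_rfl,
      chineseForm_bicyclicFamily_of_le k' le_rfl, chineseRow_bicyclicFamily_self hpq _ hrn,
      chineseRow_bicyclicFamily_self hpq _ hrn] at h
    exact (shiftUp_pow_mul_shiftDown_pow_inj K h).2
  · have hX : IsChineseFamily (n + 1) fun _ => (X : K[X]) :=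
      ⟨fun _ _ _ _ _ _ => rfl, fun _ _ _ _ _ _ => rfl⟩
    have h := map_eq_of_forall_prime hst (lift hX) (isPrimeTwoSided_ker_of_isDomain _)
    rw [lift_chineseForm, lift_chineseForm, chineseForm_const, chineseForm_const] at h
    simpa only [natDegree_X_pow] using congrArg natDegree h

/-- For the Chinese monoid `M` of rank `n` and any field `K`, the natural homomorphism
`M → ∏_P M/ρ_P` over the minimal primes `P` of `K[M]` is injective, and (equivalently) the
congruences `ρ_P` intersect in the trivial congruence. -/
theorem theorem3p3p2 (K : Type*) [Field K] (n : ℕ) (hn : 1 ≤ n) :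
    Function.Injective (toProdMinimalPrimes K (ChineseMonoid n)) ∧
      (⨅ P ∈ minimalPrimeIdeals (ChineseAlgebra K n), congruenceOfIdeal P) = ⊥ := by
  have key {s t : ChineseMonoid n}
      (h : ∀ P ∈ minimalPrimeIdeals (ChineseAlgebra K n), congruenceOfIdeal P s t) : s = t := by
    refine ChineseMonoid.eq_of_forall_prime K hn fun P hP => ?_
    obtain ⟨Q, hQ, hQP⟩ := hP.exists_minimalPrimeIdeals_le
    exact hQP (h Q hQ)
  refine ⟨fun s t hst => key fun P hP => ?_, le_bot_iff.1 fun s t hst => key fun P hP => ?_⟩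
  · exact (Con.eq _).1 (congrFun hst ⟨P, hP⟩)
  · exact (iInf₂_le (f := fun P (_ : P ∈ minimalPrimeIdeals (ChineseAlgebra K n)) =>
      congruenceOfIdeal P) P hP) hst
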